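/- Let $p\ge 1$, let $S$ be a $p\times p$ symmetric positive semidefinite matrix, $\lambda>0$ and $\alpha\in[0,1]$. On the set $\mathcal M_+$ of symmetric positive definite $p\times p$ matrices let $$\phi_\alpha(\theta)=-\log\det\theta+\mathrm{Tr}(\theta S)+g_\alpha(\theta),\qquad g_\alpha(\theta)=\sum_{i,j}\Big(\alpha\lambda|\theta_{ij}|+\tfrac{1-\alpha}{2}\lambda\,\theta_{ij}^2\Big),$$ and let $\hat\theta$ be a minimizer of $\phi_\alpha$ over $\mathcal M_+$. For $0<\ell\le\psi<\infty$ let $\mathcal M_+(\ell,\psi)$ be the set of $\theta\in\mathcal M_+$ with $\lambda_{\min}(\theta)\ge\ell$ and $\lambda_{\max}(\theta)\le\psi$. For $\gamma>0$ and a symmetric matrix $\theta$, let $$\mathrm{Prox}_\gamma(\theta;\alpha)=\operatorname{argmin}_{u}\Big\{g_\alpha(u)+\tfrac1{2\gamma}\|u-\theta\|_F^2\Big\},$$ the minimum being over all symmetric matrices $u$. Let $N\ge1$ be an integer, let $(\gamma_r)_{r\ge0}$ be positive step sizes, and let $(\zeta_k)_{k\ge1}$ be positive numbers with $\sum_k\zeta_k=\infty$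 and $\sum_k\zeta_k^2<\infty$. Consider the following algorithm, started with $r=0$. 1. Set $k=0$ and choose $\theta_0,\Sigma_0\in\mathcal M_+$ (possibly at random, depending on the past). 2. Given the past, generate $z_1,\dots,z_N$ i.i.d. from $N(0,\theta_k^{-1})$, and set $\Sigma_{k+1}=\Sigma_k+\zeta_{k+1}\big(\frac1N\sum_{i=1}^N z_iz_i'-\Sigma_k\big)$. 3. Set $\theta_{k+1}=\mathrm{Prox}_{\gamma_r}\big(\theta_k-\gamma_r(S-\Sigma_{k+1});\alpha\big)$. 4. If $\lambda_{\min}(\theta_{k+1})\le0$, increase $r$ by one and go back to 1 (restart); otherwise increase $k$ by one and go to 2. Suppose that $\hat\theta\in\mathcal M_+(\ell,\psi)$. Then, almost surely, the following holds for every run of the algorithm (the iterations from the start, or from a restart, up to the next restart if there is one) whose step size $\gamma=\gamma_r$ satisfies $\gamma\le\ell^2$. If the run is never restarted, its iterates satisfy $\theta_k\in\mathcal M_+(\ell,\psi)$ for all $k\ge0$ (in particular $\theta_0\in\mathcal M_+(\ell,\psi)$), and the sequence $(\theta_k)$ converges, then $\lim_{k\to\infty}\theta_k=\hat\theta$. 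-/

import Mathlib

open MeasureTheory ProbabilityTheory Filter Topology Matrix

namespace PrecisionMatrix

/-- `f(θ) = -log det θ + Tr(θ S)`, used on positive definite matrices only. -/
noncomputable def f {p : ℕ} (S θ : Matrix (Fin p) (Fin p) ℝ) : ℝ :=
  -Real.log θ.det + (θ * S).trace

/-- The elastic-net regularizer `g_α`. -/
noncomputable def g {p : ℕ} (lam α : ℝ) (θ : Matrix (Fin p) (Fin p) ℝ) : ℝ :=
  ∑ i, ∑ j, (α * lam * |θ i j| + (1 - α) / 2 * lam * θ i j ^ 2)

/-- The objective `φ_α = f + g_α` on positive definite matrices. -/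
noncomputable def phi {p : ℕ} (S : Matrix (Fin p) (Fin p) ℝ) (lam α : ℝ)
    (θ : Matrix (Fin p) (Fin p) ℝ) : ℝ :=
  f S θ + g lam α θ

/-- `θhat` minimizes the objective over the set of (symmetric) positive definite matrices. -/
def IsSolution {p : ℕ} (S : Matrix (Fin p) (Fin p) ℝ) (lam α : ℝ)
    (θhat : Matrix (Fin p) (Fin p) ℝ) : Prop :=
  θhat.PosDef ∧ IsMinOn (phi S lam α) {θ | θ.PosDef} θhat

/-- The positive definite matrices with smallest eigenvalue at least `ℓ` and largest eigenvalue
at most `ψ`. -/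
def MPlus (p : ℕ) (ℓ ψ : ℝ) : Set (Matrix (Fin p) (Fin p) ℝ) :=
  {θ | θ.PosDef ∧ ∀ μ ∈ spectrum ℝ θ, ℓ ≤ μ ∧ μ ≤ ψ}

/-- The squared Frobenius norm `Tr(A' A)`. -/
def froSq {p : ℕ} (A : Matrix (Fin p) (Fin p) ℝ) : ℝ :=
  (Aᵀ * A).trace

/-- `T` is the value at `θ` of the proximal operator `Prox_γ( · ; α)`, that is, `T` minimizes
`u ↦ g_α(u) + ‖u - θ‖² / (2 γ)` over all symmetric matrices. -/
def IsProx {p : ℕ} (lam α γ : ℝ) (θ T : Matrix (Fin p) (Fin p) ℝ) : Prop :=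
  T.IsSymm ∧ IsMinOn (fun u => g lam α u + 1 / (2 * γ) * froSq (u - θ)) {u | u.IsSymm} T

/-- The sample second-moment matrix `N⁻¹ ∑ z_i z_i'`. -/
noncomputable def sampleCov {p N : ℕ} (z : Fin N → EuclideanSpace ℝ (Fin p)) :
    Matrix (Fin p) (Fin p) ℝ :=
  (N : ℝ)⁻¹ • ∑ i, vecMulVec (fun a => z i a) (fun b => z i b)

/-- The Robbins–Monro update of `Sg` with weight `ζ` and fresh samples `z`. -/
noncomputable def updateSigma {p N : ℕ} (ζ : ℝ) (Sg : Matrix (Fin p) (Fin p) ℝ)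
    (z : Fin N → EuclideanSpace ℝ (Fin p)) : Matrix (Fin p) (Fin p) ℝ :=
  Sg + ζ • (sampleCov z - Sg)

/-- The first index at which a sequence is outside `MPlus p ℓ ψ` (`⊤` if there is none). -/
noncomputable def exitTime {p : ℕ} (ℓ ψ : ℝ) (x : ℕ → Matrix (Fin p) (Fin p) ℝ) : ℕ∞ :=
  sInf {t : ℕ∞ | ∃ k : ℕ, t = k ∧ x k ∉ MPlus p ℓ ψ}

/-- The stochastic algorithm with recycled samples, including its restarts. The time `n` counts all
iterations. At time `n` the state consists of the number `r n` of restarts made so far, the counter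
`k n` of iterations since the latest restart, and the current matrices `θ n`, `Sg n`; `z n` are the
`N` samples generated from this state, and `𝓕 n` is the information available before they are
generated. The step size in use is `γ (r n)`. -/
structure IsAlgorithm {p : ℕ} {Ω : Type*} {mΩ : MeasurableSpace Ω}
    (S : Matrix (Fin p) (Fin p) ℝ) (lam α : ℝ) (N : ℕ) (γ ζ : ℕ → ℝ)
    (P : Measure Ω) (𝓕 : Filtration ℕ mΩ) (r k : ℕ → Ω → ℕ)
    (θ Sg : ℕ → Ω → Matrix (Fin p) (Fin p) ℝ)
    (z : ℕ → Ω → Fin N → EuclideanSpace ℝ (Fin p)) : Prop where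
  /-- The state at time `n` belongs to the past of time `n`. -/
  measurable_r : ∀ n, Measurable[𝓕 n] (r n)
  measurable_k : ∀ n, Measurable[𝓕 n] (k n)
  measurable_θ : ∀ n i j, Measurable[𝓕 n] (fun ω => θ n ω i j)
  measurable_Sg : ∀ n i j, Measurable[𝓕 n] (fun ω => Sg n ω i j)
  /-- The samples generated at time `n` are known at time `n + 1`. -/
  measurable_z : ∀ n, Measurable[𝓕 (n + 1)] (z n)
  /-- Initially there has been no restart, and the counter is zero. -/
  init : ∀ ω, r 0 ω = 0 ∧ k 0 ω = 0
  /-- At the start of every run, positive definite matrices are chosen. -/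
  start : ∀ n ω, k n ω = 0 → (θ n ω).PosDef ∧ (Sg n ω).PosDef
  /-- Given the past, the samples are i.i.d. centered Gaussian with covariance matrix `θ⁻¹`. -/
  sampling : ∀ n (B : Set (Fin N → EuclideanSpace ℝ (Fin p))), MeasurableSet B →
    P⟦z n ⁻¹' B | 𝓕 n⟧ =ᵐ[P] fun ω =>
      (Measure.pi fun _ : Fin N => multivariateGaussian 0 (θ n ω)⁻¹).real B
  /-- A proximal step `T` is computed; it is accepted if all its eigenvalues are positive;
  otherwise the algorithm restarts with the next step size. -/
  step : ∀ n ω, ∃ T : Matrix (Fin p) (Fin p) ℝ,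
    IsProx lam α (γ (r n ω))
      (θ n ω - γ (r n ω) • (S - updateSigma (ζ (k n ω + 1)) (Sg n ω) (z n ω))) T ∧
    ((∀ μ ∈ spectrum ℝ T, 0 < μ) →
      r (n + 1) ω = r n ω ∧ k (n + 1) ω = k n ω + 1 ∧ θ (n + 1) ω = T ∧
        Sg (n + 1) ω = updateSigma (ζ (k n ω + 1)) (Sg n ω) (z n ω)) ∧
    ((∃ μ ∈ spectrum ℝ T, μ ≤ 0) → r (n + 1) ω = r n ω + 1 ∧ k (n + 1) ω = 0)

end PrecisionMatrix

namespace PrecisionMatrix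

/-! On a run that stays in `MPlus p ℓ ψ` and converges to `L`, the matrix `Sg` is a Robbins–Monro
average of noisy copies of `θ⁻¹`. If the noise is negligible, `Sg` tends to `L⁻¹`, and the proximal
step passes to the limit: `L` is the proximal point of `L - γ • (S - L⁻¹)`. By convexity of `g` such
a fixed point satisfies a first-order variational inequality, and strict concavity of `log det` then
forces `L = θhat` (`eq_of_isProx_of_isSolution`).

The noise, the sample second moment minus `θ⁻¹`, has conditional mean zero, and its conditional
second moment is bounded because `θ ≥ ℓ` bounds the diagonal of `θ⁻¹` by `ℓ⁻¹`. With square-summable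
weights its weighted sums form an L²-bounded martingale, hence converge almost surely
(`ae_exists_tendsto_sum_mul`), and `tendsto_of_robbinsMonro` applies.

Never restarting and never leaving `MPlus p ℓ ψ` are events about the future, so conditioning on
them would destroy the martingale property. Instead the noise is truncated by a condition on the
current `θ` only, and convergence is proved for every deterministic starting time `n`, a countable
family. On a good run the truncation is inactive. -/

/-! ### Positive definite matrices and the tangent inequality for `log det` -/

theorem isClosed_posSemidef (p : ℕ) : IsClosed {A : Matrix (Fin p) (Fin p) ℝ | A.PosSemidef} := by
  simp_rw [posSemidef_iff_dotProduct_mulVec, Set.ofPred_and, Set.ofPred_forall]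
  refine IsClosed.inter ?_ (isClosed_iInter fun x => ?_)
  · exact isClosed_eq (continuous_id.matrix_conjTranspose) continuous_id
  · exact isClosed_le continuous_const
      (continuous_const.dotProduct (continuous_id.matrix_mulVec continuous_const))

/-- This turns the spectral lower bound into a condition in the Loewner order, which is closed and
so survives the limit. -/
theorem posSemidef_sub_of_mem_MPlus {p : ℕ} {ℓ ψ : ℝ} {A : Matrix (Fin p) (Fin p) ℝ}
    (hA : A ∈ MPlus p ℓ ψ) : (A - ℓ • (1 : Matrix (Fin p) (Fin p) ℝ)).PosSemidef := by
  rw [posSemidef_iff_isHermitian_and_spectrum_nonneg]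
  refine ⟨hA.1.1.sub (by simp [IsHermitian]), fun μ hμ => ?_⟩
  have h : μ + ℓ ∈ spectrum ℝ A := by
    rw [← Algebra.algebraMap_eq_smul_one] at hμ
    simpa using spectrum.add_mem_add_iff (s := ℓ).2 hμ
  have := (hA.2 _ h).1
  simp only [Set.mem_ofPred_eq]
  linarith

theorem posDef_of_posSemidef_sub {p : ℕ} {ℓ : ℝ} (hℓ : 0 < ℓ) {A : Matrix (Fin p) (Fin p) ℝ}
    (hA : (A - ℓ • (1 : Matrix (Fin p) (Fin p) ℝ)).PosSemidef) : A.PosDef := by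
  simpa using PosDef.posSemidef_add hA ((PosDef.one (n := Fin p) (R := ℝ)).smul hℓ)

/-- For `x = A⁻¹ eᵢ`, the quadratic form of `A` at `x` is `xᵢ`, and it is at least `ℓ |x|² ≥ ℓ xᵢ²`.
-/
theorem inv_diag_le {p : ℕ} {ℓ : ℝ} (hℓ : 0 < ℓ) {A : Matrix (Fin p) (Fin p) ℝ}
    (hA : (A - ℓ • (1 : Matrix (Fin p) (Fin p) ℝ)).PosSemidef) (i : Fin p) :
    A⁻¹ i i ≤ ℓ⁻¹ := by
  have hpd := posDef_of_posSemidef_sub hℓ hA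
  have hdet : IsUnit A.det := hpd.det_pos.ne'.isUnit
  set x : Fin p → ℝ := A⁻¹ *ᵥ Pi.single i 1 with hx
  have hxi : x i = A⁻¹ i i := by simp [hx]
  have hAx : A *ᵥ x = Pi.single i 1 := by
    rw [hx, mulVec_mulVec, mul_nonsing_inv _ hdet, one_mulVec]
  have h := hA.dotProduct_mulVec_nonneg x
  rw [sub_mulVec, hAx, smul_mulVec, one_mulVec, dotProduct_sub, dotProduct_smul] at h
  have hsq : x i ^ 2 ≤ x ⬝ᵥ x := by
    simp only [dotProduct, ← pow_two]
    exact Finset.single_le_sum (f := fun j => x j ^ 2) (fun j _ => sq_nonneg _) (Finset.mem_univ i)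
  simp only [star_trivial, dotProduct_single, mul_one, smul_eq_mul] at h
  have hpos : 0 < A⁻¹ i i := hpd.inv.diag_pos
  rw [← hxi] at hpos ⊢
  rw [le_inv_comm₀ hpos hℓ, ← one_div, le_div_iff₀ hpos]
  nlinarith

/-- Sum `log t ≤ t - 1` over the eigenvalues; the inequality is strict unless `t = 1`. -/
theorem log_det_le_trace_sub {p : ℕ} {M : Matrix (Fin p) (Fin p) ℝ} (hM : M.PosDef) :
    Real.log M.det ≤ M.trace - p ∧ (Real.log M.det = M.trace - p → M = 1) := by
  have hpos := hM.eigenvalues_pos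
  have hdet : Real.log M.det = ∑ i, Real.log (hM.1.eigenvalues i) := by
    rw [hM.1.det_eq_prod_eigenvalues]
    exact Real.log_prod fun i _ => (hpos i).ne'
  have htr : M.trace - p = ∑ i, (hM.1.eigenvalues i - 1) := by
    rw [hM.1.trace_eq_sum_eigenvalues]
    simp
  have hle : ∀ i ∈ Finset.univ, Real.log (hM.1.eigenvalues i) ≤ hM.1.eigenvalues i - 1 :=
    fun i _ => Real.log_le_sub_one_of_pos (hpos i)
  rw [hdet, htr]
  refine ⟨Finset.sum_le_sum hle, fun h => ?_⟩
  have h1 : ∀ i, hM.1.eigenvalues i = 1 := by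
    intro i
    by_contra hne
    exact (Real.log_lt_sub_one_of_pos (hpos i) hne).ne
      ((Finset.sum_eq_sum_iff_of_le hle).1 h i (Finset.mem_univ i))
  have hE : hM.1.eigenvalues = fun _ => 1 := funext h1
  rw [hM.1.spectral_theorem, hE]
  have : (diagonal (RCLike.ofReal ∘ fun _ : Fin p => (1 : ℝ)) : Matrix (Fin p) (Fin p) ℝ) = 1 := by
    ext i j; simp [diagonal, one_apply]
  rw [this, map_one]

open scoped MatrixOrder in
-- Strict concavity of `log det`, as a tangent inequality at `L`. Writing `L⁻¹ = Bᴴ B`, the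
-- congruence `B v Bᴴ` reduces it to the case `L = 1`.
theorem log_det_sub_le_trace {p : ℕ} {L v : Matrix (Fin p) (Fin p) ℝ} (hL : L.PosDef)
    (hv : v.PosDef) :
    Real.log v.det - Real.log L.det ≤ (L⁻¹ * v).trace - p ∧
      (Real.log v.det - Real.log L.det = (L⁻¹ * v).trace - p → v = L) := by
  obtain ⟨B, hB⟩ := CStarAlgebra.nonneg_iff_eq_star_mul_self.1 hL.inv.posSemidef.nonneg
  rw [star_eq_conjTranspose] at hB
  have hBdet : B.det ≠ 0 := by
    intro h0
    have := hL.inv.det_pos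
    rw [hB, det_mul, h0, mul_zero] at this
    exact this.false
  have hBu : IsUnit B := (isUnit_iff_isUnit_det B).2 hBdet.isUnit
  have hM : (B * v * Bᴴ).PosDef := (Matrix.IsUnit.posDef_star_right_conjugate_iff hBu).2 hv
  have htr : (B * v * Bᴴ).trace = (L⁻¹ * v).trace := by
    rw [trace_mul_comm, ← mul_assoc, ← hB]
  have hdet : Real.log (B * v * Bᴴ).det = Real.log v.det - Real.log L.det := by
    have h1 : (B * v * Bᴴ).det = L⁻¹.det * v.det := by
      rw [hB]; simp only [det_mul]; ring
    rw [h1, det_nonsing_inv, Ring.inverse_eq_inv', Real.log_mul (inv_ne_zero hL.det_pos.ne')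
      hv.det_pos.ne', Real.log_inv]
    ring
  obtain ⟨h1, h2⟩ := log_det_le_trace_sub hM
  rw [htr, hdet] at h1 h2
  refine ⟨h1, fun h => ?_⟩
  have h3 := h2 h
  have hBH : IsUnit Bᴴ.det := by simpa using hBdet
  have h4 : v = B⁻¹ * (Bᴴ)⁻¹ := by
    rw [← mul_one B⁻¹, ← h3, mul_assoc, mul_assoc, mul_nonsing_inv _ hBH, mul_one, ← mul_assoc,
      nonsing_inv_mul _ hBdet.isUnit, one_mul]
  rw [h4, ← Matrix.mul_inv_rev, ← hB, nonsing_inv_nonsing_inv _ hL.det_pos.ne'.isUnit]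

/-! ### The regularizer and fixed points of the proximal gradient map -/

theorem continuous_g {p : ℕ} (lam α : ℝ) :
    Continuous (g lam α : Matrix (Fin p) (Fin p) ℝ → ℝ) := by
  unfold g
  have : ∀ i j, Continuous fun θ : Matrix (Fin p) (Fin p) ℝ => θ i j :=
    fun i j => continuous_id.matrix_elem i j
  fun_prop

theorem continuous_froSq {p : ℕ} : Continuous (froSq : Matrix (Fin p) (Fin p) ℝ → ℝ) :=
  ((continuous_id.matrix_transpose).matrix_mul continuous_id).matrix_trace

theorem g_segment_le {p : ℕ} {lam α : ℝ} (hlam : 0 ≤ lam) (hα : α ∈ Set.Icc (0 : ℝ) 1)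
    (A B : Matrix (Fin p) (Fin p) ℝ) {t : ℝ} (ht : t ∈ Set.Icc (0 : ℝ) 1) :
    g lam α (A + t • (B - A)) ≤ g lam α A + t * (g lam α B - g lam α A) := by
  have hrhs : g lam α A + t * (g lam α B - g lam α A) = (1 - t) * g lam α A + t * g lam α B := by
    ring
  rw [hrhs]
  unfold g
  simp only [Finset.mul_sum, ← Finset.sum_add_distrib]
  refine Finset.sum_le_sum fun i _ => Finset.sum_le_sum fun j _ => ?_
  simp only [Matrix.add_apply, Matrix.smul_apply, Matrix.sub_apply, smul_eq_mul]
  generalize A i j = a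
  generalize B i j = b
  obtain ⟨ht0, ht1⟩ := ht
  have h1 : |a + t * (b - a)| ≤ (1 - t) * |a| + t * |b| := by
    have : a + t * (b - a) = (1 - t) * a + t * b := by ring
    rw [this]
    refine (abs_add_le _ _).trans_eq ?_
    rw [abs_mul, abs_mul, abs_of_nonneg ht0, abs_of_nonneg (sub_nonneg.2 ht1)]
  have h2 : (a + t * (b - a)) ^ 2 ≤ (1 - t) * a ^ 2 + t * b ^ 2 := by
    nlinarith [mul_nonneg (mul_nonneg ht0 (sub_nonneg.2 ht1)) (sq_nonneg (a - b))]
  have h3 := mul_le_mul_of_nonneg_left h1 (mul_nonneg hα.1 hlam)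
  have h4 := mul_le_mul_of_nonneg_left h2
    (mul_nonneg (div_nonneg (sub_nonneg.2 hα.2) zero_le_two) hlam)
  linarith

theorem froSq_smul_add {p : ℕ} (t γ : ℝ) (A B : Matrix (Fin p) (Fin p) ℝ) :
    froSq (t • A + γ • B) = t ^ 2 * froSq A + 2 * t * γ * (Aᵀ * B).trace + γ ^ 2 * froSq B := by
  have h : (Bᵀ * A).trace = (Aᵀ * B).trace := by
    rw [← trace_transpose, transpose_mul, transpose_transpose]
  simp only [froSq, transpose_add, transpose_smul, add_mul, mul_add, trace_add, Matrix.smul_mul, Matrix.mul_smul,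
    trace_smul, smul_eq_mul, h]
  ring

/-- Optimality condition at a fixed point of the proximal gradient map. -/
theorem variational_of_isProx {p : ℕ} {lam α γ : ℝ} (hlam : 0 ≤ lam)
    (hα : α ∈ Set.Icc (0 : ℝ) 1) (hγ : 0 < γ) {L D v : Matrix (Fin p) (Fin p) ℝ}
    (h : IsProx lam α γ (L - γ • D) L) (hv : v.IsSymm) :
    0 ≤ g lam α v - g lam α L + ((v - L) * D).trace := by
  set W := v - L with hW
  have hWs : Wᵀ = W := by rw [hW, transpose_sub, hv, h.1]
  -- Minimality at `L` is tested along the segment `L + t • W`. After division by `t` only the term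
  -- quadratic in `W` retains a factor `t`, and it vanishes as `t → 0+`.
  have key : ∀ t ∈ Set.Ioc (0 : ℝ) 1,
      0 ≤ g lam α v - g lam α L + (W * D).trace + t * (1 / (2 * γ) * froSq W) := by
    intro t ht
    have hsymm : (L + t • W).IsSymm := by
      rw [IsSymm, transpose_add, transpose_smul, hWs, h.1]
    have h1 := h.2 hsymm
    simp only [Set.mem_ofPred_eq] at h1
    have e1 : L - (L - γ • D) = (0 : ℝ) • W + γ • D := by simp
    have e2 : L + t • W - (L - γ • D) = t • W + γ • D := by abel
    rw [e1, e2, froSq_smul_add, froSq_smul_add, hWs] at h1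
    have h2 := g_segment_le hlam hα L v (Set.Ioc_subset_Icc_self ht)
    rw [← hW] at h2
    have e3 : 1 / (2 * γ) * (t ^ 2 * froSq W + 2 * t * γ * (W * D).trace + γ ^ 2 * froSq D)
        = t * (t * (1 / (2 * γ) * froSq W) + (W * D).trace) + 1 / (2 * γ) * (γ ^ 2 * froSq D) := by
      field_simp
    rw [e3] at h1
    have h3 : 0 ≤ t * (g lam α v - g lam α L + (W * D).trace + t * (1 / (2 * γ) * froSq W)) := by
      nlinarith
    exact nonneg_of_mul_nonneg_right h3 ht.1
  have hlim : Tendsto (fun t : ℝ => g lam α v - g lam α L + (W * D).trace +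
      t * (1 / (2 * γ) * froSq W)) (𝓝[>] 0) (𝓝 (g lam α v - g lam α L + (W * D).trace)) := by
    have : Continuous fun t : ℝ => g lam α v - g lam α L + (W * D).trace +
      t * (1 / (2 * γ) * froSq W) := by fun_prop
    simpa using (this.tendsto 0).mono_left nhdsWithin_le_nhds
  refine ge_of_tendsto hlim ?_
  filter_upwards [Ioc_mem_nhdsGT (zero_lt_one' ℝ)] with t ht using key t ht

/-- A positive definite fixed point of the proximal gradient map is the solution. -/
theorem eq_of_isProx_of_isSolution {p : ℕ} {S : Matrix (Fin p) (Fin p) ℝ} {lam α γ : ℝ}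
    (hlam : 0 ≤ lam) (hα : α ∈ Set.Icc (0 : ℝ) 1) (hγ : 0 < γ)
    {L θhat : Matrix (Fin p) (Fin p) ℝ} (hL : L.PosDef) (hθ : IsSolution S lam α θhat)
    (h : IsProx lam α γ (L - γ • (S - L⁻¹)) L) : L = θhat := by
  have h1 := variational_of_isProx hlam hα hγ h (v := θhat) hθ.1.1
  have h2 := hθ.2 hL
  simp only [Set.mem_ofPred_eq, phi, f] at h2
  obtain ⟨h3, h4⟩ := log_det_sub_le_trace hL hθ.1
  have e1 : ((θhat - L) * (S - L⁻¹)).trace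
      = (θhat * S).trace - (L * S).trace - ((L⁻¹ * θhat).trace - p) := by
    rw [sub_mul, mul_sub, mul_sub, mul_nonsing_inv _ hL.det_pos.ne'.isUnit, trace_sub, trace_sub,
      trace_sub, trace_one, trace_mul_comm θhat L⁻¹]
    simp only [Fintype.card_fin]
    ring
  rw [e1] at h1
  -- The variational inequality `h1` and minimality of `θhat` give the reverse of the tangent
  -- inequality `h3`, so the equality case applies.
  exact (h4 (by linarith)).symm

/-- The graph of the proximal operator is closed. -/
theorem isProx_of_tendsto {p : ℕ} {lam α γ : ℝ} {w T : ℕ → Matrix (Fin p) (Fin p) ℝ}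
    {w' T' : Matrix (Fin p) (Fin p) ℝ} (h : ∀ n, IsProx lam α γ (w n) (T n))
    (hw : Tendsto w atTop (𝓝 w')) (hT : Tendsto T atTop (𝓝 T')) : IsProx lam α γ w' T' := by
  have hF : ∀ {a b : ℕ → Matrix (Fin p) (Fin p) ℝ} {a' b' : Matrix (Fin p) (Fin p) ℝ},
      Tendsto a atTop (𝓝 a') → Tendsto b atTop (𝓝 b') →
      Tendsto (fun n => g lam α (a n) + 1 / (2 * γ) * froSq (a n - b n)) atTop
        (𝓝 (g lam α a' + 1 / (2 * γ) * froSq (a' - b'))) := fun ha hb =>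
    (((continuous_g lam α).tendsto _).comp ha).add
      ((((continuous_froSq).tendsto _).comp (ha.sub hb)).const_mul _)
  refine ⟨?_, fun u hu => ?_⟩
  · have hc : IsClosed {A : Matrix (Fin p) (Fin p) ℝ | A.IsSymm} :=
      isClosed_eq continuous_id.matrix_transpose continuous_id
    exact hc.mem_of_tendsto hT (Eventually.of_forall fun n => (h n).1)
  · exact le_of_tendsto_of_tendsto' (hF hT hw) (hF tendsto_const_nhds hw) fun n => (h n).2 hu

/-! ### Deterministic Robbins–Monro recursions -/

/-- Weighted averages of a convergent sequence, with weights of divergent sum, converge. -/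
theorem tendsto_of_averaging {u a b : ℕ → ℝ} {B : ℝ} (ha : ∀ j, 0 < a j)
    (ha0 : Tendsto a atTop (𝓝 0)) (hsum : ¬ Summable a) (hb : Tendsto b atTop (𝓝 B))
    (hu : ∀ j, u (j + 1) = u j + a j * (b j - u j)) : Tendsto u atTop (𝓝 B) := by
  rw [Metric.tendsto_atTop]
  intro ε hε
  have h1 : ∀ᶠ j in atTop, a j ≤ 1 := ha0.eventually_le_const zero_lt_one
  have h2 : ∀ᶠ j in atTop, |b j - B| < ε / 2 := by
    simpa [Real.dist_eq] using (Metric.tendsto_nhds.1 hb) (ε / 2) (half_pos hε)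
  obtain ⟨J, hJ⟩ := eventually_atTop.1 (h1.and h2)
  -- Beyond `J` the target is within `ε / 2` of `B`, so each step multiplies the excess of the
  -- distance over `ε / 2` by at most `1 - a ≤ exp (-a)`.
  have key : ∀ n, |u (J + n) - B| - ε / 2
      ≤ Real.exp (-∑ i ∈ Finset.range n, a (J + i)) * |u J - B| := by
    intro n
    induction n with
    | zero => simp; linarith
    | succ n ih =>
      obtain ⟨ha1, hb1⟩ := hJ (J + n) (by omega)
      have e1 : u (J + (n + 1)) - B
          = (1 - a (J + n)) * (u (J + n) - B) + a (J + n) * (b (J + n) - B) := by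
        rw [← add_assoc, hu]; ring
      have e2 : |u (J + (n + 1)) - B|
          ≤ (1 - a (J + n)) * |u (J + n) - B| + a (J + n) * |b (J + n) - B| := by
        rw [e1]
        refine (abs_add_le _ _).trans_eq ?_
        rw [abs_mul, abs_mul, abs_of_nonneg (sub_nonneg.2 ha1), abs_of_pos (ha _)]
      have e3 : a (J + n) * |b (J + n) - B| ≤ a (J + n) * (ε / 2) :=
        mul_le_mul_of_nonneg_left hb1.le (ha _).le
      have e4 := mul_le_mul_of_nonneg_left ih (sub_nonneg.2 ha1)
      have e5 : (1 - a (J + n)) * (Real.exp (-∑ i ∈ Finset.range n, a (J + i)) * |u J - B|)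
          ≤ Real.exp (-a (J + n)) * (Real.exp (-∑ i ∈ Finset.range n, a (J + i)) * |u J - B|) :=
        mul_le_mul_of_nonneg_right (Real.one_sub_le_exp_neg _) (by positivity)
      rw [Finset.sum_range_succ, neg_add, Real.exp_add]
      nlinarith
  have hS : Tendsto (fun n => ∑ i ∈ Finset.range n, a (J + i)) atTop atTop := by
    refine (not_summable_iff_tendsto_nat_atTop_of_nonneg fun i => (ha _).le).1 ?_
    simp_rw [add_comm J]
    rwa [summable_nat_add_iff]
  have hE : Tendsto (fun n => Real.exp (-∑ i ∈ Finset.range n, a (J + i)) * |u J - B|) atTop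
      (𝓝 0) := by
    simpa using (Real.tendsto_exp_neg_atTop_nhds_zero.comp hS).mul_const |u J - B|
  obtain ⟨n, hn⟩ := eventually_atTop.1 (hE.eventually_lt_const (half_pos hε))
  refine ⟨J + n, fun m hm => ?_⟩
  obtain ⟨d, rfl⟩ := Nat.exists_eq_add_of_le hm
  have h3 := key (n + d)
  have h4 := hn (n + d) (by omega)
  rw [Real.dist_eq, add_assoc]
  linarith

/-- Convergence of a Robbins–Monro recursion whose weighted noise is summable. -/
theorem tendsto_of_robbinsMonro {y a c d : ℕ → ℝ} {B M : ℝ} (ha : ∀ j, 0 < a j)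
    (ha0 : Tendsto a atTop (𝓝 0)) (hsum : ¬ Summable a) (hc : Tendsto c atTop (𝓝 B))
    (hd : Tendsto (fun n => ∑ i ∈ Finset.range n, a i * d i) atTop (𝓝 M))
    (hy : ∀ j, y (j + 1) = y j + a j * (c j + d j - y j)) : Tendsto y atTop (𝓝 B) := by
  -- Subtracting the partial noise sums from both `y` and the target `c` leaves an exact averaging
  -- recursion, with limit `B - M`; adding the sums back restores `B`.
  have h := tendsto_of_averaging (u := fun j => y j - ∑ i ∈ Finset.range j, a i * d i)
    (b := fun j => c j - ∑ i ∈ Finset.range j, a i * d i) ha ha0 hsum (hc.sub hd)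
    (fun j => by rw [Finset.sum_range_succ, hy]; ring)
  simpa using h.add hd

/-! ### Martingale convergence of the weighted noise -/

/-- A martingale with square-summable weights and increments bounded in `L²` converges. -/
theorem ae_exists_tendsto_sum_mul {Ω : Type*} {mΩ : MeasurableSpace Ω} {P : Measure Ω}
    [IsProbabilityMeasure P] {𝓕 : Filtration ℕ mΩ} {D : ℕ → Ω → ℝ} {c : ℕ → ℝ} {C : ℝ}
    (hc : Summable fun n => c n ^ 2) (hmeas : ∀ n, StronglyMeasurable[𝓕 (n + 1)] (D n))
    (hL2 : ∀ n, MemLp (D n) 2 P) (hC : ∀ n, ∫ ω, D n ω ^ 2 ∂P ≤ C)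
    (hcond : ∀ n, P[D n | 𝓕 n] =ᵐ[P] 0) :
    ∀ᵐ ω ∂P, ∃ l, Tendsto (fun n => ∑ i ∈ Finset.range n, c i * D i ω) atTop (𝓝 l) := by
  set M : ℕ → Ω → ℝ := fun n ω => ∑ i ∈ Finset.range n, c i * D i ω with hM
  have hMsucc : ∀ n, M (n + 1) = M n + c n • D n := by
    intro n; ext ω; simp [hM, Finset.sum_range_succ]
  have hadp : StronglyAdapted 𝓕 M := fun n =>
    Finset.stronglyMeasurable_fun_sum _ fun i hi =>
      ((hmeas i).mono (𝓕.mono (Finset.mem_range.1 hi))).const_mul _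
  have hM2 : ∀ n, MemLp (M n) 2 P := fun n =>
    memLp_finsetSum _ fun i _ => (hL2 i).const_mul _
  have hint : ∀ n, Integrable (M n) P := fun n => (hM2 n).integrable one_le_two
  have hmart : Martingale M 𝓕 P := by
    refine martingale_of_condExp_sub_eq_zero_nat hadp hint fun n => ?_
    rw [hMsucc, add_sub_cancel_left]
    filter_upwards [condExp_smul (μ := P) (c n) (D n) (𝓕 n), hcond n] with ω h1 h2
    rw [h1, Pi.smul_apply, h2]; simp
  -- `M n` is known at time `n`, so it factors out of the conditional expectation of `M n * D n`;
  -- the cross terms in the second moment vanish.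
  have horth : ∀ n, ∫ ω, M n ω * D n ω ∂P = 0 := by
    intro n
    have hi : Integrable (M n * D n) P := (hM2 n).integrable_mul (hL2 n)
    have h := condExp_mul_of_stronglyMeasurable_left (hadp n) hi
      ((hL2 n).integrable one_le_two)
    have h0 : P[M n * D n | 𝓕 n] =ᵐ[P] 0 := by
      filter_upwards [h, hcond n] with ω h1 h2
      rw [h1, Pi.mul_apply, h2]; simp
    have := integral_condExp (μ := P) (f := M n * D n) (𝓕.le n)
    rw [integral_congr_ae h0] at this
    simpa using this.symm
  have hsq : ∀ n, ∫ ω, M n ω ^ 2 ∂P ≤ C * ∑ i ∈ Finset.range n, c i ^ 2 := by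
    intro n
    induction n with
    | zero => simp [hM]
    | succ n ih =>
      have e : ∫ ω, M (n + 1) ω ^ 2 ∂P
          = ∫ ω, M n ω ^ 2 ∂P + 2 * c n * ∫ ω, M n ω * D n ω ∂P
            + c n ^ 2 * ∫ ω, D n ω ^ 2 ∂P := by
        rw [← integral_const_mul, ← integral_const_mul, ← integral_add, ← integral_add]
        · refine integral_congr_ae (Eventually.of_forall fun ω => ?_)
          simp only [hMsucc, Pi.add_apply, Pi.smul_apply, smul_eq_mul]
          ring
        · exact (hM2 n).integrable_sq.add (((hM2 n).integrable_mul (hL2 n)).const_mul _)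
        · exact (hL2 n).integrable_sq.const_mul _
        · exact (hM2 n).integrable_sq
        · exact ((hM2 n).integrable_mul (hL2 n)).const_mul _
      rw [e, horth, Finset.sum_range_succ]
      nlinarith [mul_le_mul_of_nonneg_left (hC n) (sq_nonneg (c n))]
  have hC0 : 0 ≤ C := (integral_nonneg fun _ => sq_nonneg _).trans (hC 0)
  set R : ℝ := 1 + C * ∑' n, c n ^ 2 with hR
  have hR0 : 0 ≤ R := by
    have : 0 ≤ ∑' n, c n ^ 2 := tsum_nonneg fun _ => sq_nonneg _
    positivity
  -- Doob's theorem needs only an L¹ bound, which follows from the L² bound and `|x| ≤ 1 + x²`.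
  refine hmart.submartingale.exists_ae_tendsto_of_bdd (R := R.toNNReal) fun n => ?_
  rw [eLpNorm_one_eq_lintegral_enorm, ← ofReal_integral_norm_eq_lintegral_enorm (hint n)]
  refine ENNReal.ofReal_le_ofReal ?_
  calc ∫ ω, ‖M n ω‖ ∂P ≤ ∫ ω, (1 + M n ω ^ 2) ∂P := by
        refine integral_mono (hint n).norm ((integrable_const _).add (hM2 n).integrable_sq) ?_
        intro ω
        simp only [Real.norm_eq_abs]
        nlinarith [sq_abs (M n ω), sq_nonneg (|M n ω| - 1), abs_nonneg (M n ω)]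
    _ = 1 + ∫ ω, M n ω ^ 2 ∂P := by
        rw [integral_add (integrable_const _) (hM2 n).integrable_sq]; simp
    _ ≤ R := by
        have := mul_le_mul_of_nonneg_left
          (hc.sum_le_tsum (Finset.range n) fun _ _ => sq_nonneg _) hC0
        linarith [hsq n]

/-! ### From conditional probabilities of sets to conditional laws -/

/-- Two probability kernels that agree almost surely on each measurable set of a countably
generated space agree almost surely. -/
theorem ae_eq_of_forall_ae_measureReal_eq {Ω E : Type*} {mΩ : MeasurableSpace Ω}
    [MeasurableSpace E] [MeasurableSpace.CountablyGenerated E] {P : Measure Ω}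
    {μ ν : Ω → Measure E} (hμ : ∀ ω, IsProbabilityMeasure (μ ω))
    (hν : ∀ ω, IsProbabilityMeasure (ν ω))
    (h : ∀ B, MeasurableSet B → ∀ᵐ ω ∂P, (μ ω).real B = (ν ω).real B) :
    ∀ᵐ ω ∂P, μ ω = ν ω := by
  -- A countable generating algebra is a π-system, so countably many null sets suffice.
  set A := generateSetAlgebra (MeasurableSpace.countableGeneratingSet E)
  have hA : A.Countable :=
    countable_generateSetAlgebra (MeasurableSpace.countable_countableGeneratingSet)
  have hgen : ‹MeasurableSpace E› = MeasurableSpace.generateFrom A := by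
    rw [generateFrom_generateSetAlgebra_eq, MeasurableSpace.generateFrom_countableGeneratingSet]
  have hall : ∀ᵐ ω ∂P, ∀ B ∈ A, (μ ω).real B = (ν ω).real B := by
    rw [ae_ball_iff hA]
    intro B hB
    refine h B ?_
    rw [hgen]
    exact MeasurableSpace.measurableSet_generateFrom hB
  filter_upwards [hall] with ω hω
  have := hμ ω
  have := hν ω
  refine ext_of_generate_finite A hgen (fun s hs t ht _ =>
    isSetAlgebra_generateSetAlgebra.inter_mem hs ht) (fun s hs => ?_) (by simp)
  exact (measureReal_eq_measureReal_iff).1 (hω s hs)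

section Disintegration

variable {Ω β E : Type*} {mΩ : MeasurableSpace Ω} {mβ : MeasurableSpace β} [MeasurableSpace E]
  [StandardBorelSpace E] [Nonempty E] {P : Measure Ω} [IsProbabilityMeasure P] {X : Ω → β}
  {Y : Ω → E} {ν : Ω → Measure E}

/-- The sampling rule is given set by set, each with its own null set. Identifying the whole
conditional law allows integration of functions of `X` and `Y` jointly, with `X` frozen. -/
theorem condDistrib_ae_eq_of_condProb (hX : Measurable X) (hY : Measurable Y)
    (hν : ∀ ω, IsProbabilityMeasure (ν ω))
    (h : ∀ B, MeasurableSet B → P⟦Y ⁻¹' B | mβ.comap X⟧ =ᵐ[P] fun ω => (ν ω).real B) :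
    ∀ᵐ ω ∂P, condDistrib Y X P (X ω) = ν ω := by
  refine ae_eq_of_forall_ae_measureReal_eq (fun ω => inferInstance) hν fun B hB => ?_
  filter_upwards [h B hB, condDistrib_ae_eq_condExp (μ := P) hX hY hB] with ω h1 h2
  rw [h2, h1]

theorem lintegral_eq_of_condProb (hX : Measurable X) (hY : Measurable Y)
    (hν : ∀ ω, IsProbabilityMeasure (ν ω))
    (h : ∀ B, MeasurableSet B → P⟦Y ⁻¹' B | mβ.comap X⟧ =ᵐ[P] fun ω => (ν ω).real B)
    {F : β × E → ENNReal} (hF : Measurable F) :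
    ∫⁻ ω, F (X ω, Y ω) ∂P = ∫⁻ ω, ∫⁻ y, F (X ω, y) ∂ν ω ∂P := by
  have h1 : ∫⁻ ω, F (X ω, Y ω) ∂P = ∫⁻ q, F q ∂(P.map fun ω => (X ω, Y ω)) :=
    (lintegral_map hF (hX.prodMk hY)).symm
  rw [h1, ← compProd_map_condDistrib hY.aemeasurable, Measure.lintegral_compProd hF,
    lintegral_map (hF.lintegral_kernel_prod_right') hX]
  refine lintegral_congr_ae ?_
  filter_upwards [condDistrib_ae_eq_of_condProb hX hY hν h] with ω hω
  rw [hω]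

theorem condExp_eq_of_condProb (hX : Measurable X) (hY : Measurable Y)
    (hν : ∀ ω, IsProbabilityMeasure (ν ω))
    (h : ∀ B, MeasurableSet B → P⟦Y ⁻¹' B | mβ.comap X⟧ =ᵐ[P] fun ω => (ν ω).real B)
    {F : β × E → ℝ} (hF : Measurable F) (hint : Integrable (fun ω => F (X ω, Y ω)) P) :
    P[fun ω => F (X ω, Y ω) | mβ.comap X] =ᵐ[P] fun ω => ∫ y, F (X ω, y) ∂ν ω := by
  filter_upwards [condDistrib_ae_eq_of_condProb hX hY hν h,
    condExp_prod_ae_eq_integral_condDistrib hX hY.aemeasurable hF.stronglyMeasurable hint]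
    with ω h1 h2
  rw [h2, h1]

end Disintegration

/-! ### Gaussian moments and sample covariances -/

/-- The fourth moment of the standard Gaussian distribution. -/
noncomputable def fourthMoment : ℝ := ∫ x, x ^ 4 ∂gaussianReal 0 1

theorem fourthMoment_nonneg : 0 ≤ fourthMoment :=
  integral_nonneg fun x => by positivity

theorem integral_pow_four_gaussianReal (v : NNReal) :
    ∫ x, x ^ 4 ∂gaussianReal 0 v = (v : ℝ) ^ 2 * fourthMoment := by
  have h : gaussianReal 0 v = (gaussianReal 0 1).map (fun x => Real.sqrt v * x) := by
    rw [gaussianReal_map_const_mul]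
    congr 1
    · simp
    · ext; simp
  rw [h, integral_map (by fun_prop) (by fun_prop), fourthMoment, ← integral_const_mul]
  congr 1 with x
  rw [mul_pow, show Real.sqrt v ^ 4 = (Real.sqrt v ^ 2) ^ 2 by ring,
    Real.sq_sqrt (NNReal.coe_nonneg v)]

section Moments

variable {p : ℕ} {V : Matrix (Fin p) (Fin p) ℝ}

theorem integrable_pow_four_multivariateGaussian (hV : V.PosSemidef) (a : Fin p) :
    Integrable (fun x : EuclideanSpace ℝ (Fin p) => x a ^ 4) (multivariateGaussian 0 V) := by
  have hmp := measurePreserving_eval_multivariateGaussian (μ := 0) hV (i := a)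
  have h : Integrable (fun x : ℝ => x ^ 4) (gaussianReal 0 (V a a).toNNReal) := by
    have := (memLp_id_gaussianReal (μ := 0) (v := (V a a).toNNReal) 4).integrable_norm_pow
      (by norm_num)
    simpa [Even.pow_abs (by decide : Even 4)] using this
  exact hmp.integrable_comp_of_integrable h

theorem integral_pow_four_multivariateGaussian (hV : V.PosSemidef) (a : Fin p) :
    ∫ x : EuclideanSpace ℝ (Fin p), x a ^ 4 ∂multivariateGaussian 0 V
      = V a a ^ 2 * fourthMoment := by
  have hmp := measurePreserving_eval_multivariateGaussian (μ := 0) hV (i := a)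
  have h := integral_map (μ := multivariateGaussian 0 V) hmp.measurable.aemeasurable
    (f := fun x : ℝ => x ^ 4) (by fun_prop)
  rw [← h, hmp.map_eq]
  simp only [PiLp.zero_apply]
  rw [integral_pow_four_gaussianReal, Real.coe_toNNReal _ hV.diag_nonneg]

theorem memLp_mul_multivariateGaussian (hV : V.PosSemidef) (a b : Fin p) :
    MemLp (fun x : EuclideanSpace ℝ (Fin p) => x a * x b) 2 (multivariateGaussian 0 V) := by
  rw [memLp_two_iff_integrable_sq (Measurable.aestronglyMeasurable (by fun_prop))]
  refine ((integrable_pow_four_multivariateGaussian hV a).add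
    (integrable_pow_four_multivariateGaussian hV b)).mono'
    (Measurable.aestronglyMeasurable (by fun_prop)) (Eventually.of_forall fun x => ?_)
  rw [Real.norm_of_nonneg (sq_nonneg _), Pi.add_apply]
  nlinarith [sq_nonneg (x a ^ 2 - x b ^ 2), sq_nonneg (x a ^ 2), sq_nonneg (x b ^ 2)]

theorem integral_mul_multivariateGaussian (hV : V.PosSemidef) (a b : Fin p) :
    ∫ x : EuclideanSpace ℝ (Fin p), x a * x b ∂multivariateGaussian 0 V = V a b := by
  have hm : ∀ i : Fin p, ∫ x : EuclideanSpace ℝ (Fin p), x i ∂multivariateGaussian 0 V = 0 := by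
    intro i
    have := (EuclideanSpace.proj (𝕜 := ℝ) i).integral_comp_comm
      (IsGaussian.integrable_fun_id (μ := multivariateGaussian 0 V))
    simpa using this
  have h := covariance_eval_multivariateGaussian (μ := 0) hV a b
  simpa [covariance, hm] using h

/-- The variance is at most the second moment, and `(xₐ x_b)² ≤ (xₐ⁴ + x_b⁴) / 2` leaves only
one-dimensional marginals. -/
theorem integral_sq_sub_multivariateGaussian_le (hV : V.PosSemidef) {C : ℝ}
    (hC : ∀ i, V i i ≤ C) (a b : Fin p) :
    ∫ x : EuclideanSpace ℝ (Fin p), (x a * x b - V a b) ^ 2 ∂multivariateGaussian 0 V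
      ≤ C ^ 2 * fourthMoment := by
  have hL := memLp_mul_multivariateGaussian hV a b
  have h4 : ∀ i, ∫ x : EuclideanSpace ℝ (Fin p), x i ^ 4 ∂multivariateGaussian 0 V
      ≤ C ^ 2 * fourthMoment := fun i => by
    rw [integral_pow_four_multivariateGaussian hV]
    exact mul_le_mul_of_nonneg_right (pow_le_pow_left₀ hV.diag_nonneg (hC i) 2)
      fourthMoment_nonneg
  have h1 : ∫ x : EuclideanSpace ℝ (Fin p), (x a * x b - V a b) ^ 2 ∂multivariateGaussian 0 V
      ≤ ∫ x : EuclideanSpace ℝ (Fin p), (x a * x b) ^ 2 ∂multivariateGaussian 0 V := by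
    have := variance_le_expectation_sq hL.aestronglyMeasurable
    rwa [variance_eq_integral hL.aestronglyMeasurable.aemeasurable,
      integral_mul_multivariateGaussian hV] at this
  have h2 : ∫ x : EuclideanSpace ℝ (Fin p), (x a * x b) ^ 2 ∂multivariateGaussian 0 V
      ≤ ∫ x : EuclideanSpace ℝ (Fin p), (2⁻¹ * x a ^ 4 + 2⁻¹ * x b ^ 4)
        ∂multivariateGaussian 0 V := by
    refine integral_mono hL.integrable_sq
      (((integrable_pow_four_multivariateGaussian hV a).const_mul _).add
        ((integrable_pow_four_multivariateGaussian hV b).const_mul _)) fun x => ?_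
    simp only
    nlinarith [sq_nonneg (x a ^ 2 - x b ^ 2)]
  rw [integral_add ((integrable_pow_four_multivariateGaussian hV a).const_mul _)
    ((integrable_pow_four_multivariateGaussian hV b).const_mul _), integral_const_mul,
    integral_const_mul] at h2
  linarith [h4 a, h4 b]

variable {N : ℕ}

theorem sampleCov_sub_apply (hN : 1 ≤ N) (y : Fin N → EuclideanSpace ℝ (Fin p)) (a b : Fin p) :
    sampleCov y a b - V a b = (N : ℝ)⁻¹ * ∑ i, (y i a * y i b - V a b) := by
  have : (N : ℝ) ≠ 0 := by positivity
  simp only [sampleCov, Matrix.smul_apply, Matrix.sum_apply, vecMulVec_apply, smul_eq_mul,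
    Finset.sum_sub_distrib, Finset.sum_const, Finset.card_univ, Fintype.card_fin, nsmul_eq_mul]
  field_simp

theorem memLp_eval_pi_multivariateGaussian (hV : V.PosSemidef) (a b : Fin p) (i : Fin N) :
    MemLp (fun y : Fin N → EuclideanSpace ℝ (Fin p) => y i a * y i b - V a b) 2
      (Measure.pi fun _ => multivariateGaussian 0 V) :=
  ((memLp_mul_multivariateGaussian hV a b).sub (memLp_const (V a b))).comp_measurePreserving
    (measurePreserving_eval (fun _ : Fin N => multivariateGaussian 0 V) i)

theorem memLp_sampleCov_sub (hV : V.PosSemidef) (hN : 1 ≤ N) (a b : Fin p) :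
    MemLp (fun y : Fin N → EuclideanSpace ℝ (Fin p) => sampleCov y a b - V a b) 2
      (Measure.pi fun _ => multivariateGaussian 0 V) := by
  simp_rw [sampleCov_sub_apply hN]
  exact (memLp_finsetSum _ fun i _ => memLp_eval_pi_multivariateGaussian hV a b i).const_mul _

theorem integral_sampleCov_sub (hV : V.PosSemidef) (hN : 1 ≤ N) (a b : Fin p) :
    ∫ y : Fin N → EuclideanSpace ℝ (Fin p), (sampleCov y a b - V a b)
      ∂(Measure.pi fun _ => multivariateGaussian 0 V) = 0 := by
  simp_rw [sampleCov_sub_apply hN]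
  rw [integral_const_mul, integral_finsetSum _ fun i _ =>
    (memLp_eval_pi_multivariateGaussian hV a b i).integrable one_le_two,
    Finset.sum_eq_zero, mul_zero]
  intro i _
  rw [integral_comp_eval (μ := fun _ : Fin N => multivariateGaussian 0 V)
    (f := fun x : EuclideanSpace ℝ (Fin p) => x a * x b - V a b)
    (Measurable.aestronglyMeasurable (by fun_prop)),
    integral_sub ((memLp_mul_multivariateGaussian hV a b).integrable one_le_two)
    (integrable_const _), integral_mul_multivariateGaussian hV]
  simp

/-- Cauchy–Schwarz on the average suffices; independence of the samples would gain only a factor `1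
/ N`. -/
theorem integral_sq_sampleCov_sub_le (hV : V.PosSemidef) (hN : 1 ≤ N) {C : ℝ}
    (hC : ∀ i, V i i ≤ C) (a b : Fin p) :
    ∫ y : Fin N → EuclideanSpace ℝ (Fin p), (sampleCov y a b - V a b) ^ 2
      ∂(Measure.pi fun _ => multivariateGaussian 0 V) ≤ C ^ 2 * fourthMoment := by
  have hN0 : (N : ℝ) ≠ 0 := by positivity
  have hi : ∀ i : Fin N, ∫ y : Fin N → EuclideanSpace ℝ (Fin p), (y i a * y i b - V a b) ^ 2
      ∂(Measure.pi fun _ => multivariateGaussian 0 V) ≤ C ^ 2 * fourthMoment := by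
    intro i
    rw [integral_comp_eval (μ := fun _ : Fin N => multivariateGaussian 0 V)
      (f := fun x : EuclideanSpace ℝ (Fin p) => (x a * x b - V a b) ^ 2)
      (Measurable.aestronglyMeasurable (by fun_prop))]
    exact integral_sq_sub_multivariateGaussian_le hV hC a b
  have hint := fun i : Fin N => (memLp_eval_pi_multivariateGaussian hV a b i).integrable_sq
  calc _ ≤ ∫ y : Fin N → EuclideanSpace ℝ (Fin p),
        (N : ℝ)⁻¹ * ∑ i, (y i a * y i b - V a b) ^ 2
        ∂(Measure.pi fun _ => multivariateGaussian 0 V) := by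
        refine integral_mono (memLp_sampleCov_sub hV hN a b).integrable_sq
          ((integrable_finsetSum _ fun i _ => hint i).const_mul _) fun y => ?_
        simp only [sampleCov_sub_apply hN]
        have := sq_sum_le_card_mul_sum_sq (s := Finset.univ)
          (f := fun i => y i a * y i b - V a b)
        rw [Finset.card_univ, Fintype.card_fin] at this
        rw [mul_pow]
        calc _ ≤ ((N : ℝ)⁻¹) ^ 2 * (N * ∑ i, (y i a * y i b - V a b) ^ 2) := by gcongr
          _ = _ := by field_simp
    _ = (N : ℝ)⁻¹ * ∑ i, ∫ y : Fin N → EuclideanSpace ℝ (Fin p), (y i a * y i b - V a b) ^ 2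
        ∂(Measure.pi fun _ => multivariateGaussian 0 V) := by
        rw [integral_const_mul, integral_finsetSum _ fun i _ => hint i]
    _ ≤ (N : ℝ)⁻¹ * ∑ _i : Fin N, C ^ 2 * fourthMoment := by
        gcongr with i
        exact hi i
    _ = _ := by
        rw [Finset.sum_const, Finset.card_univ, Fintype.card_fin, nsmul_eq_mul]
        field_simp

end Moments

/-! ### The truncated sampling noise -/

section Noise

variable {p N : ℕ}

theorem measurable_comp_of_continuous {β : Type*} [MeasurableSpace β]
    {A : β → Matrix (Fin p) (Fin p) ℝ} (hA : ∀ i j, Measurable fun ω => A ω i j)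
    {F : Matrix (Fin p) (Fin p) ℝ → ℝ} (hF : Continuous F) : Measurable fun ω => F (A ω) := by
  have h : Continuous (fun B : Fin p → Fin p → ℝ => F (Matrix.of B)) := hF
  exact h.measurable.comp (g := fun B : Fin p → Fin p → ℝ => F (Matrix.of B))
    (measurable_pi_lambda _ fun i => measurable_pi_lambda _ fun j => hA i j)

theorem measurableSet_preimage_of_isClosed {β : Type*} [MeasurableSpace β]
    {A : β → Matrix (Fin p) (Fin p) ℝ} (hA : ∀ i j, Measurable fun ω => A ω i j)
    {s : Set (Matrix (Fin p) (Fin p) ℝ)} (hs : IsClosed s) : MeasurableSet (A ⁻¹' s) := by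
  have h : IsClosed (X := Fin p → Fin p → ℝ) s := hs
  exact (measurable_pi_lambda (fun ω => (A ω : Fin p → Fin p → ℝ)) fun i =>
    measurable_pi_lambda _ fun j => hA i j) h.measurableSet

theorem measurable_inv_apply {β : Type*} [MeasurableSpace β]
    {A : β → Matrix (Fin p) (Fin p) ℝ} (hA : ∀ i j, Measurable fun ω => A ω i j) (i j : Fin p) :
    Measurable fun ω => (A ω)⁻¹ i j := by
  simp only [Matrix.inv_def, Ring.inverse_eq_inv', Matrix.smul_apply, smul_eq_mul]
  exact (measurable_comp_of_continuous hA continuous_id.matrix_det).inv.mul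
    (measurable_comp_of_continuous hA (continuous_id.matrix_adjugate.matrix_elem i j))

/-- The positive semidefinite matrices with diagonal entries at most `C`. -/
def boundedPosSemidef (p : ℕ) (C : ℝ) : Set (Matrix (Fin p) (Fin p) ℝ) :=
  {V | V.PosSemidef ∧ ∀ i, V i i ≤ C}

theorem isClosed_boundedPosSemidef (C : ℝ) : IsClosed (boundedPosSemidef p C) := by
  have : boundedPosSemidef p C =
      {V : Matrix (Fin p) (Fin p) ℝ | V.PosSemidef} ∩ ⋂ i, {V | V i i ≤ C} := by
    ext V; simp [boundedPosSemidef]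
  rw [this]
  exact (isClosed_posSemidef p).inter
    (isClosed_iInter fun i => isClosed_le (continuous_id.matrix_elem i i) continuous_const)

open scoped Classical in
/-- An entry of the sampling error, set to zero when the covariance matrix is not bounded. -/
noncomputable def truncatedNoise (C : ℝ) (a b : Fin p) (A : Matrix (Fin p) (Fin p) ℝ)
    (y : Fin N → EuclideanSpace ℝ (Fin p)) : ℝ :=
  if A⁻¹ ∈ boundedPosSemidef p C then sampleCov y a b - A⁻¹ a b else 0

theorem measurable_truncatedNoise {β : Type*} [MeasurableSpace β]
    {A : β → Matrix (Fin p) (Fin p) ℝ} (hA : ∀ i j, Measurable fun ω => A ω i j) (C : ℝ)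
    (a b : Fin p) :
    Measurable fun q : β × (Fin N → EuclideanSpace ℝ (Fin p)) =>
      truncatedNoise C a b (A q.1) q.2 := by
  refine Measurable.ite ?_ (Measurable.sub ?_ ?_) measurable_const
  · exact measurable_fst (measurableSet_preimage_of_isClosed (measurable_inv_apply hA)
      (isClosed_boundedPosSemidef C))
  · simp only [sampleCov, Matrix.smul_apply, Matrix.sum_apply, vecMulVec_apply, smul_eq_mul]
    fun_prop
  · exact (measurable_inv_apply hA a b).comp measurable_fst

theorem integral_truncatedNoise (hN : 1 ≤ N) (C : ℝ) (a b : Fin p)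
    (A : Matrix (Fin p) (Fin p) ℝ) :
    ∫ y : Fin N → EuclideanSpace ℝ (Fin p), truncatedNoise C a b A y
      ∂(Measure.pi fun _ => multivariateGaussian 0 A⁻¹) = 0 := by
  unfold truncatedNoise
  split_ifs with h
  · exact integral_sampleCov_sub h.1 hN a b
  · simp

/-- The truncation depends on `A` alone, so given `A` the noise stays centered, and its second
moment is bounded uniformly over all `A`. -/
theorem lintegral_sq_truncatedNoise_le (hN : 1 ≤ N) (C : ℝ) (a b : Fin p)
    (A : Matrix (Fin p) (Fin p) ℝ) :
    ∫⁻ y : Fin N → EuclideanSpace ℝ (Fin p), ENNReal.ofReal (truncatedNoise C a b A y ^ 2)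
      ∂(Measure.pi fun _ => multivariateGaussian 0 A⁻¹)
      ≤ ENNReal.ofReal (C ^ 2 * fourthMoment) := by
  unfold truncatedNoise
  split_ifs with h
  · rw [← ofReal_integral_eq_lintegral_ofReal (memLp_sampleCov_sub h.1 hN a b).integrable_sq
      (Eventually.of_forall fun _ => sq_nonneg _)]
    exact ENNReal.ofReal_le_ofReal (integral_sq_sampleCov_sub_le h.1 hN h.2 a b)
  · simp

section Conditional

variable {Ω β : Type*} {mΩ : MeasurableSpace Ω} {mβ : MeasurableSpace β} {P : Measure Ω}
  [IsProbabilityMeasure P] {X : Ω → β} {A : β → Matrix (Fin p) (Fin p) ℝ}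
  {z : Ω → Fin N → EuclideanSpace ℝ (Fin p)}

/-- A bound on the lower integral presupposes no integrability; square integrability of the noise is
deduced from it. -/
theorem lintegral_sq_truncatedNoise_comp_le (hN : 1 ≤ N) (hX : Measurable X)
    (hA : ∀ i j, Measurable fun x => A x i j) (hz : Measurable z)
    (hs : ∀ B, MeasurableSet B → P⟦z ⁻¹' B | mβ.comap X⟧ =ᵐ[P] fun ω =>
      (Measure.pi fun _ : Fin N => multivariateGaussian 0 (A (X ω))⁻¹).real B) (C : ℝ)
    (a b : Fin p) :
    ∫⁻ ω, ENNReal.ofReal (truncatedNoise C a b (A (X ω)) (z ω) ^ 2) ∂P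
      ≤ ENNReal.ofReal (C ^ 2 * fourthMoment) := by
  have hF : Measurable fun q : β × (Fin N → EuclideanSpace ℝ (Fin p)) =>
      ENNReal.ofReal (truncatedNoise C a b (A q.1) q.2 ^ 2) :=
    ((measurable_truncatedNoise hA C a b).pow_const 2).ennreal_ofReal
  have h := lintegral_eq_of_condProb hX hz (fun ω => inferInstance) hs hF
  rw [h]
  calc _ ≤ ∫⁻ _, ENNReal.ofReal (C ^ 2 * fourthMoment) ∂P :=
        lintegral_mono fun ω => lintegral_sq_truncatedNoise_le hN C a b (A (X ω))
    _ = _ := by rw [lintegral_const, measure_univ, mul_one]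

theorem memLp_truncatedNoise (hN : 1 ≤ N) (hX : Measurable X)
    (hA : ∀ i j, Measurable fun x => A x i j) (hz : Measurable z)
    (hs : ∀ B, MeasurableSet B → P⟦z ⁻¹' B | mβ.comap X⟧ =ᵐ[P] fun ω =>
      (Measure.pi fun _ : Fin N => multivariateGaussian 0 (A (X ω))⁻¹).real B) (C : ℝ)
    (a b : Fin p) :
    MemLp (fun ω => truncatedNoise C a b (A (X ω)) (z ω)) 2 P := by
  have hF := measurable_truncatedNoise (N := N) hA C a b
  have hmeas : Measurable fun ω => truncatedNoise C a b (A (X ω)) (z ω) := by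
    simpa only [Function.comp_def] using hF.comp (hX.prodMk hz)
  refine (memLp_two_iff_integrable_sq hmeas.aestronglyMeasurable).2
    ⟨(hmeas.pow_const 2).aestronglyMeasurable, ?_⟩
  rw [hasFiniteIntegral_iff_ofReal (Eventually.of_forall fun _ => sq_nonneg _)]
  exact (lintegral_sq_truncatedNoise_comp_le hN hX hA hz hs C a b).trans_lt ENNReal.ofReal_lt_top

theorem integral_sq_truncatedNoise_le (hN : 1 ≤ N) (hX : Measurable X)
    (hA : ∀ i j, Measurable fun x => A x i j) (hz : Measurable z)
    (hs : ∀ B, MeasurableSet B → P⟦z ⁻¹' B | mβ.comap X⟧ =ᵐ[P] fun ω =>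
      (Measure.pi fun _ : Fin N => multivariateGaussian 0 (A (X ω))⁻¹).real B) (C : ℝ)
    (a b : Fin p) :
    ∫ ω, truncatedNoise C a b (A (X ω)) (z ω) ^ 2 ∂P ≤ C ^ 2 * fourthMoment := by
  have hle := lintegral_sq_truncatedNoise_comp_le hN hX hA hz hs C a b
  rw [← ofReal_integral_eq_lintegral_ofReal
    (memLp_truncatedNoise hN hX hA hz hs C a b).integrable_sq
    (Eventually.of_forall fun _ => sq_nonneg _)] at hle
  exact (ENNReal.ofReal_le_ofReal_iff (mul_nonneg (sq_nonneg C) fourthMoment_nonneg)).1 hle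

theorem condExp_truncatedNoise (hN : 1 ≤ N) (hX : Measurable X)
    (hA : ∀ i j, Measurable fun x => A x i j) (hz : Measurable z)
    (hs : ∀ B, MeasurableSet B → P⟦z ⁻¹' B | mβ.comap X⟧ =ᵐ[P] fun ω =>
      (Measure.pi fun _ : Fin N => multivariateGaussian 0 (A (X ω))⁻¹).real B) (C : ℝ)
    (a b : Fin p) :
    P[fun ω => truncatedNoise C a b (A (X ω)) (z ω) | mβ.comap X] =ᵐ[P] 0 := by
  have h := condExp_eq_of_condProb hX hz (fun ω => inferInstance) hs
    (measurable_truncatedNoise hA C a b)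
    ((memLp_truncatedNoise hN hX hA hz hs C a b).integrable one_le_two)
  filter_upwards [h] with ω hω
  rw [hω]
  exact integral_truncatedNoise hN C a b (A (X ω))

end Conditional

end Noise

/-! ### Runs of the algorithm and their noise -/

theorem mem_MPlus_of_exitTime_eq_top {p : ℕ} {ℓ ψ : ℝ} {x : ℕ → Matrix (Fin p) (Fin p) ℝ}
    (h : exitTime ℓ ψ x = ⊤) (j : ℕ) : x j ∈ MPlus p ℓ ψ := by
  by_contra hj
  have : exitTime ℓ ψ x ≤ j := sInf_le ⟨j, rfl, hj⟩
  rw [h] at this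
  exact ENat.natCast_ne_top j (top_le_iff.1 this)

theorem inv_mem_boundedPosSemidef {p : ℕ} {ℓ ψ : ℝ} (hℓ : 0 < ℓ) {A : Matrix (Fin p) (Fin p) ℝ}
    (hA : A ∈ MPlus p ℓ ψ) : A⁻¹ ∈ boundedPosSemidef p ℓ⁻¹ :=
  ⟨hA.1.inv.posSemidef, inv_diag_le hℓ (posSemidef_sub_of_mem_MPlus hA)⟩

theorem tendsto_matrix_inv {p : ℕ} {x : ℕ → Matrix (Fin p) (Fin p) ℝ}
    {L : Matrix (Fin p) (Fin p) ℝ} (hx : Tendsto x atTop (𝓝 L)) (hL : L.det ≠ 0) :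
    Tendsto (fun j => (x j)⁻¹) atTop (𝓝 L⁻¹) := by
  simp only [Matrix.inv_def, Ring.inverse_eq_inv']
  exact (((continuous_id.matrix_det.tendsto L).comp hx).inv₀ hL).smul
    ((continuous_id.matrix_adjugate.tendsto L).comp hx)

section Run

variable {p : ℕ} {Ω : Type*} {mΩ : MeasurableSpace Ω} {P : Measure Ω} {𝓕 : Filtration ℕ mΩ}
  {S : Matrix (Fin p) (Fin p) ℝ} {lam α : ℝ} {N : ℕ} {γ ζ : ℕ → ℝ} {r k : ℕ → Ω → ℕ}
  {θ Sg : ℕ → Ω → Matrix (Fin p) (Fin p) ℝ} {z : ℕ → Ω → Fin N → EuclideanSpace ℝ (Fin p)}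

/-- A rejected step would increase `r`, so a constant `r` means that every proposal is accepted. The
proximal step uses the already updated `Sg`. -/
theorem IsAlgorithm.run_step (halg : IsAlgorithm S lam α N γ ζ P 𝓕 r k θ Sg z) {ω : Ω} {n : ℕ}
    (hk : k n ω = 0) (hr : ∀ j, r (n + j) ω = r n ω) (j : ℕ) :
    k (n + j) ω = j ∧
      Sg (n + (j + 1)) ω = updateSigma (ζ (j + 1)) (Sg (n + j) ω) (z (n + j) ω) ∧
      IsProx lam α (γ (r n ω))
        (θ (n + j) ω - γ (r n ω) • (S - Sg (n + (j + 1)) ω)) (θ (n + (j + 1)) ω) := by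
  have hstep : ∀ i, k (n + (i + 1)) ω = k (n + i) ω + 1 ∧
      Sg (n + (i + 1)) ω = updateSigma (ζ (k (n + i) ω + 1)) (Sg (n + i) ω) (z (n + i) ω) ∧
      IsProx lam α (γ (r n ω))
        (θ (n + i) ω - γ (r n ω) • (S - Sg (n + (i + 1)) ω)) (θ (n + (i + 1)) ω) := by
    intro i
    obtain ⟨T, hT, hacc, hrej⟩ := halg.step (n + i) ω
    by_cases hpos : ∀ μ ∈ spectrum ℝ T, 0 < μ
    · obtain ⟨-, h2, h3, h4⟩ := hacc hpos
      rw [hr i, ← h4, ← h3] at hT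
      exact ⟨h2, h4, hT⟩
    · push Not at hpos
      have h1 := (hrej hpos).1
      have h2 := hr (i + 1)
      rw [← add_assoc, h1, hr i] at h2
      omega
  have hkj : ∀ i, k (n + i) ω = i := by
    intro i
    induction i with
    | zero => simpa using hk
    | succ i ih => rw [(hstep i).1, ih]
  refine ⟨hkj j, ?_, (hstep j).2.2⟩
  rw [(hstep j).2.1, hkj j]

/-- Almost surely, the weighted sampling errors of every run are summable. -/
theorem IsAlgorithm.ae_exists_tendsto_noise [IsProbabilityMeasure P]
    (halg : IsAlgorithm S lam α N γ ζ P 𝓕 r k θ Sg z) (hN : 1 ≤ N)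
    (hζ_sq : Summable (fun i : ℕ => ζ (i + 1) ^ 2)) (C : ℝ) :
    ∀ᵐ ω ∂P, ∀ (n : ℕ) (a b : Fin p), ∃ M, Tendsto (fun j => ∑ i ∈ Finset.range j,
      ζ (i + 1) * truncatedNoise C a b (θ (n + i) ω) (z (n + i) ω)) atTop (𝓝 M) := by
  simp only [ae_all_iff]
  intro n a b
  -- The identity into `Ω` with the σ-algebra `𝓕 i` generates `𝓕 i`, so the past itself serves as
  -- the conditioning variable.
  have hid : ∀ i, @Measurable Ω Ω mΩ (𝓕 i) id := fun i => measurable_id.mono (𝓕.le i) le_rfl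
  have hz : ∀ i, Measurable (z i) := fun i => (halg.measurable_z i).mono (𝓕.le _) le_rfl
  have hs : ∀ i, ∀ B, MeasurableSet B → P⟦z i ⁻¹' B | (𝓕 i).comap id⟧ =ᵐ[P] fun ω =>
      (Measure.pi fun _ : Fin N => multivariateGaussian 0 (θ i ω)⁻¹).real B := by
    simpa only [MeasurableSpace.comap_id] using halg.sampling
  have hL2 := fun i => memLp_truncatedNoise hN (hid i) (halg.measurable_θ i) (hz i) (hs i) C a b
  have hsq := fun i =>
    integral_sq_truncatedNoise_le hN (hid i) (halg.measurable_θ i) (hz i) (hs i) C a b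
  have hcond := fun i =>
    condExp_truncatedNoise hN (hid i) (halg.measurable_θ i) (hz i) (hs i) C a b
  simp only [MeasurableSpace.comap_id] at hcond
  have hmeas : ∀ i, StronglyMeasurable[𝓕 (i + 1)]
      fun ω => truncatedNoise C a b (θ i ω) (z i ω) := by
    intro i
    have hF := @measurable_truncatedNoise p N Ω (𝓕 (i + 1)) (θ i)
      (fun u v => (halg.measurable_θ i u v).mono (𝓕.mono i.le_succ) le_rfl) C a b
    have hid : @Measurable Ω Ω (𝓕 (i + 1)) (𝓕 (i + 1)) id := measurable_id
    exact (hF.comp (hid.prodMk (halg.measurable_z i))).stronglyMeasurable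
  -- A run starting at time `n` uses weight `ζ (i - n + 1)` at global time `i`; weight zero before
  -- `n` makes its noise sums those of a martingale in global time.
  have hc : Summable fun i => (if i < n then 0 else ζ (i - n + 1)) ^ 2 := by
    rw [← summable_nat_add_iff n]
    simpa using hζ_sq
  filter_upwards [ae_exists_tendsto_sum_mul hc hmeas hL2 hsq hcond] with ω ⟨M, hM⟩
  refine ⟨M, ?_⟩
  have h := hM.comp (tendsto_add_atTop_nat n)
  refine h.congr fun j => ?_
  rw [Function.comp_apply, add_comm j n, Finset.sum_range_add, Finset.sum_eq_zero, zero_add]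
  · exact Finset.sum_congr rfl fun i _ => by simp
  · intro i hi
    simp [Finset.mem_range.1 hi]

end Run

end PrecisionMatrix

/-! ### Identification of the limit -/

theorem theorem4 {p : ℕ} {Ω : Type*} {mΩ : MeasurableSpace Ω} (P : Measure Ω)
    [IsProbabilityMeasure P] (𝓕 : Filtration ℕ mΩ)
    (S : Matrix (Fin p) (Fin p) ℝ) (hS : S.PosSemidef)
    (lam α : ℝ) (hlam : 0 < lam) (hα : α ∈ Set.Icc (0 : ℝ) 1)
    (θhat : Matrix (Fin p) (Fin p) ℝ) (hθhat : PrecisionMatrix.IsSolution S lam α θhat)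
    (N : ℕ) (hN : 1 ≤ N)
    (γ : ℕ → ℝ) (hγ : ∀ i, 0 < γ i)
    (ζ : ℕ → ℝ) (hζ : ∀ i, 1 ≤ i → 0 < ζ i)
    (hζ_sum : ¬ Summable (fun i : ℕ => ζ (i + 1)))
    (hζ_sq : Summable (fun i : ℕ => ζ (i + 1) ^ 2))
    (r k : ℕ → Ω → ℕ) (θ Sg : ℕ → Ω → Matrix (Fin p) (Fin p) ℝ)
    (z : ℕ → Ω → Fin N → EuclideanSpace ℝ (Fin p))
    (halg : PrecisionMatrix.IsAlgorithm S lam α N γ ζ P 𝓕 r k θ Sg z)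
    (ℓ ψ : ℝ) (hℓ : 0 < ℓ) (hℓψ : ℓ ≤ ψ) (hθhat_mem : θhat ∈ PrecisionMatrix.MPlus p ℓ ψ) :
    ∀ᵐ ω ∂P, ∀ n : ℕ, k n ω = 0 → γ (r n ω) ≤ ℓ ^ 2 →
      (∀ j, r (n + j) ω = r n ω) →
      PrecisionMatrix.exitTime ℓ ψ (fun j => θ (n + j) ω) = ⊤ →
      (∃ L, Tendsto (fun j => θ (n + j) ω) atTop (𝓝 L)) →
      Tendsto (fun j => θ (n + j) ω) atTop (𝓝 θhat) := by
  filter_upwards [halg.ae_exists_tendsto_noise hN hζ_sq ℓ⁻¹] with ω hnoise n hk _ hr hexit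
  rintro ⟨L, hL⟩
  have hmem := PrecisionMatrix.mem_MPlus_of_exitTime_eq_top hexit
  have hLpd : L.PosDef := by
    refine PrecisionMatrix.posDef_of_posSemidef_sub hℓ ?_
    exact (PrecisionMatrix.isClosed_posSemidef p).mem_of_tendsto (hL.sub_const _)
      (Eventually.of_forall fun j => PrecisionMatrix.posSemidef_sub_of_mem_MPlus (hmem j))
  have hinv := PrecisionMatrix.tendsto_matrix_inv hL hLpd.det_pos.ne'
  have hrun := halg.run_step hk hr
  have hζ0 : Tendsto (fun i => ζ (i + 1)) atTop (𝓝 0) := by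
    have h := hζ_sq.tendsto_atTop_zero.sqrt
    simpa [Real.sqrt_sq (hζ _ (Nat.le_add_left 1 _)).le] using h
  have hSg : Tendsto (fun j => Sg (n + j) ω) atTop (𝓝 L⁻¹) := by
    refine tendsto_pi_nhds.2 fun a => tendsto_pi_nhds.2 fun b => ?_
    obtain ⟨M, hM⟩ := hnoise n a b
    refine PrecisionMatrix.tendsto_of_robbinsMonro (fun j => hζ _ (Nat.le_add_left 1 j)) hζ0
      hζ_sum (c := fun j => (θ (n + j) ω)⁻¹ a b)
      (((continuous_id.matrix_elem a b).tendsto _).comp hinv) hM fun j => ?_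
    -- Membership in `MPlus p ℓ ψ` makes the truncation at level `ℓ⁻¹` inactive, so the recursion
    -- for `Sg` has exactly the required form.
    rw [(hrun j).2.1, PrecisionMatrix.truncatedNoise,
      if_pos (PrecisionMatrix.inv_mem_boundedPosSemidef hℓ (hmem j))]
    simp only [PrecisionMatrix.updateSigma, Matrix.add_apply, Matrix.smul_apply,
      Matrix.sub_apply, smul_eq_mul]
    ring
  have hprox := PrecisionMatrix.isProx_of_tendsto (fun j => (hrun j).2.2)
    (hL.sub ((tendsto_const_nhds.sub (hSg.comp (tendsto_add_atTop_nat 1))).const_smul _))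
    (hL.comp (tendsto_add_atTop_nat 1))
  rwa [PrecisionMatrix.eq_of_isProx_of_isSolution hlam.le hα (hγ _) hLpd hθhat hprox] at hL
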